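/- **Setting.** Draw the hexagonal lattice $\mathbb H$ with horizontal, NW and NE edges, called edges of type $a,b,c$. Its vertices are $u_{m,n}$ (black) and $v_{m,n}$ (white), $(m,n)\in\mathbb Z^2$, where $u_{m,n}$ is joined to $v_{m,n}$ by an edge of type $c$, to $v_{m,n-1}$ by one of type $b$, and to $v_{m-1,n}$ by one of type $a$. The shifts $\tau_1,\tau_2$ add $1$ to $m$ and to $n$, respectively. A 1-2 model assigns to each vertex $x$ of $\mathbb H$ a vector $(a_x,b_x,c_x)$ of strictly positive local weights ($a_x$ is the weight of the local configurations at $x$ in which the two incident edges of types $b,c$ have the same state and the edge of type $a$ the opposite state; similarly for $b_x,c_x$). It is $k\times 1$ periodic if these vectors are invariant under $\tau_1^k$ and $\tau_2$. **Decorated graph.** The decorated graph $\mathbb H_\Delta$ has 16 vertices per cell $(m,n)$: for each of the two vertices $x\in\{u_{m,n},v_{m,n}\}$ the vertex $x$ itself and seven further vertices $A_x,B_x,C_x,L^1_x,L^2_x,L^3_x,p_x$. Writing $u=u_{m,n}$, $v=v_{m,n}$, its oriented edges are * the bisector edges $A_u\to u$ and $v\to A_v$ (horizontal, of weights $a_u,a_v$),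 $u\to B_u$ and $v\to B_v$ (NW, of weights $b_u,b_v$), $u\to C_{u_{m,n-1}}$ and $v\to C_{v_{m,n+1}}$ (NE, of weights $c_u,c_v$); * with weight $1$: the edges $A_{x'}\to B_x\to L^1_x\to A_{x'}$, $L^1_x\to L^2_x$, $C_x\to L^2_x$, $C_x\to L^3_x\to L^2_x$, $L^3_x\to p_x$, for $(x,x')=(u,v)$ and $(x,x')=(v,u)$, and $p_{u_{m,n}}\to p_{v_{m-1,n+1}}$. (Each vertex of $\mathbb H$ thus has three incident bisector edges, ending in the three hexagons around it, and the other edges form in each hexagon a planar gadget with six legs, which can be completed to a dimer configuration, and then uniquely, exactly when the number of present bisector edges is even. The orientation is clockwise odd.) **Spectral curve.** Let $\mathbb H_{\Delta,k,1}$ be the quotient of $\mathbb H_\Delta$ by the action of $\tau_1^k$ and $\tau_2$, with vertex set represented by the fundamental domain of the cells $(i,0)$, $0\le i<k$. For $z,w\in\mathbb C\setminus\{0\}$ let $K(z,w)$ be its modified weighted adjacency (Kasteleyn) matrix, of size $16k\times16k$: an edge of weight $\omega$ oriented from a vertex $p$ of the fundamental domain to the translate $\tau_1^{kr}\tau_2^{t}q$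 of a vertex $q$ of the fundamental domain contributes $\omega z^rw^t$ to the entry $(p,q)$ and $-\omega z^{-r}w^{-t}$ to the entry $(q,p)$. Let $P(z,w)=\det K(z,w)$. **Theorem.** Let $k\ge1$ and consider a $k\times1$ periodic 1-2 model with strictly positive local weights. The only possible intersection of the spectral curve $\{(z,w): P(z,w)=0\}$ with the unit torus $\mathbb T^2=\{(z,w):|z|=1,\ |w|=1\}$ is a single real point; that is, this intersection is either empty or equal to $\{(x,y)\}$ for some real $x,y$. -/

import Mathlib

/-! # The decorated dimer model of a periodic 1-2 model

The hexagonal lattice is drawn in the plane with horizontal, NW and NE edges, which are said to be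
of type `a`, `b`, `c`.  Its vertices are indexed by a cell `(m, n) : ℤ × ℤ` and a colour: the cell
`(m, n)` holds the black and the white vertex of one NE edge.  The edges are, for all `m`, `n`,
* NE (type `c`):         `(m, n, black)` to `(m, n, white)`,
* NW (type `b`):         `(m, n, black)` to `(m, n - 1, white)`,
* horizontal (type `a`): `(m, n, black)` to `(m - 1, n, white)`,
and the two shifts that generate the action of `ℤ²` add `1` to `m`, and `1` to `n`. -/

namespace OneTwo

/-- The two vertex classes of the hexagonal lattice. -/
inductive Colour
  | black
  | white
  deriving DecidableEq

instance : Fintype Colour := ⟨{.black, .white}, fun s => by cases s <;> decide⟩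

/-- The other colour. -/
def Colour.swap : Colour → Colour
  | .black => .white
  | .white => .black

/-- The parameters of a (non-homogeneous) 1-2 model: a local weight vector `(a, b, c)` at each
vertex `(m, n, colour)` of the hexagonal lattice.  The weight `a` (respectively `b`, `c`) is that of
the local configurations in which the two edges that are *not* of type `a` (respectively `b`, `c`)
have the same state, the third one having the other state. -/
structure Weights where
  a : ℤ → ℤ → Colour → ℝ
  b : ℤ → ℤ → Colour → ℝ
  c : ℤ → ℤ → Colour → ℝ

/-- All local weights are strictly positive. -/
def Weights.IsPositive (W : Weights) : Prop :=
  ∀ m n s, 0 < W.a m n s ∧ 0 < W.b m n s ∧ 0 < W.c m n s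

/-- The model is `k × l` periodic: the local weights are invariant under the `k`-th power of the
first shift and under the `l`-th power of the second shift. -/
def Weights.IsPeriodic (W : Weights) (k l : ℕ) : Prop :=
  ∀ m n s,
    (W.a (m + k) n s = W.a m n s ∧ W.b (m + k) n s = W.b m n s ∧ W.c (m + k) n s = W.c m n s) ∧
    (W.a m (n + l) s = W.a m n s ∧ W.b m (n + l) s = W.b m n s ∧ W.c m (n + l) s = W.c m n s)

/-- The sites of the decorated graph: its vertices are `(m, n, s, x)` with `(m, n)` a cell,
`s` a colour and `x` a site, that is, `16` vertices per cell.

* `centre` is the vertex `(m, n, s)` of the hexagonal lattice itself;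
* `endA`, `endB` at `(m, n, s)` are the outer ends of the horizontal and of the NW bisector edge
  at the vertex `(m, n, s)`;
* `endC` at `(m, n, black)` (respectively `(m, n, white)`) is the outer end of the NE bisector edge
  at the vertex `(m, n + 1, black)` (respectively `(m, n - 1, white)`);
* `link₁`, `link₂`, `link₃`, `port` are auxiliary vertices.

Each hexagon holds six ends of bisector edges, one for each of its corners: those of colour `s`
called `endB`, `endC` and that of the opposite colour called `endA` in one cell with `s = black`,
and likewise in a neighbouring cell with `s = white`. -/
inductive Site
  | centre
  | endA
  | endB
  | endC
  | link₁
  | link₂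
  | link₃
  | port
  deriving DecidableEq

instance : Fintype Site :=
  ⟨{.centre, .endA, .endB, .endC, .link₁, .link₂, .link₃, .port}, fun x => by cases x <;> decide⟩

/-- The edges of the decorated graph, up to the action of `ℤ²`.

The edges `legA`, `legB`, `legC` are the horizontal, NW and NE bisector edges.  The other ones form,
inside each hexagon, a planar gadget with six legs: four triangles
(`endA`, `endB`, `link₁`) and (`link₂`, `endC`, `link₃`), for each of the two colours, which are
connected in a row by `link₁ - link₂` (twice), and in the middle by the path
`link₃ - port - port - link₃`.  A set of bisector edges in which each `centre` has exactly one
edge extends to a perfect matching of the graph if and only if each hexagon holds an even number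
of them, and then in exactly one way. -/
inductive EdgeType
  | legA (s : Colour)
  | legB (s : Colour)
  | legC (s : Colour)
  | triAB (s : Colour)
  | triB1 (s : Colour)
  | tri1A (s : Colour)
  | link12 (s : Colour)
  | triC2 (s : Colour)
  | triC3 (s : Colour)
  | tri32 (s : Colour)
  | link3p (s : Colour)
  | portport
  deriving DecidableEq, Fintype

open Colour Site EdgeType

/-- The tail of an edge in the chosen clockwise odd orientation (colour and site). -/
def EdgeType.tail : EdgeType → Colour × Site
  | legA black => (black, endA)
  | legA white => (white, centre)
  | legB s => (s, centre)
  | legC s => (s, centre)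
  | triAB s => (s.swap, endA)
  | triB1 s => (s, endB)
  | tri1A s => (s, link₁)
  | link12 s => (s, link₁)
  | triC2 s => (s, endC)
  | triC3 s => (s, endC)
  | tri32 s => (s, link₃)
  | link3p s => (s, link₃)
  | portport => (black, port)

/-- The head of an edge in the chosen clockwise odd orientation (colour and site). -/
def EdgeType.head : EdgeType → Colour × Site
  | legA black => (black, centre)
  | legA white => (white, endA)
  | legB s => (s, endB)
  | legC s => (s, endC)
  | triAB s => (s, endB)
  | triB1 s => (s, link₁)
  | tri1A s => (s.swap, endA)
  | link12 s => (s, link₂)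
  | triC2 s => (s, link₂)
  | triC3 s => (s, link₃)
  | tri32 s => (s, link₂)
  | link3p s => (s, port)
  | portport => (white, port)

/-- The cell of the head of an edge, relative to the cell of its tail. -/
def EdgeType.shift : EdgeType → ℤ × ℤ
  | legC black => (0, -1)
  | legC white => (0, 1)
  | portport => (-1, 1)
  | _ => (0, 0)

/-- The weight of the edge whose tail is in the cell `(m, n)`: the local weight `a`, `b`, `c` of the
incident vertex of the hexagonal lattice for horizontal, NW, NE bisector edges, and `1` for the
other edges. -/
def EdgeType.weight (W : Weights) (m n : ℤ) : EdgeType → ℝ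
  | legA s => W.a m n s
  | legB s => W.b m n s
  | legC s => W.c m n s
  | _ => 1

/-- The vertices of the quotient of the decorated graph by the `k`-th power of the first shift and
the `l`-th power of the second: those in the cells `(i, j)`, `0 ≤ i < k`, `0 ≤ j < l`, which form
a fundamental domain. -/
abbrev TorusVertex (k l : ℕ) : Type := Fin k × Fin l × Colour × Site

/-- The sum of the modified weights of the oriented edges of the toroidal graph from `p` to `q`:
an edge that leads from `p` in the fundamental domain to the translate of `q` by `r` times the
first and `t` times the second period has its weight multiplied by `z ^ r * w ^ t`. -/
noncomputable def forward (W : Weights) (k l : ℕ) (z w : ℂ) (p q : TorusVertex k l) : ℂ :=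
  ∑ e : EdgeType,
    if e.tail = p.2.2 ∧ e.head = q.2.2 ∧
        (k : ℤ) ∣ (p.1 : ℤ) + e.shift.1 - (q.1 : ℤ) ∧
        (l : ℤ) ∣ (p.2.1 : ℤ) + e.shift.2 - (q.2.1 : ℤ) then
      (e.weight W (p.1 : ℤ) (p.2.1 : ℤ) : ℂ) *
        z ^ (((p.1 : ℤ) + e.shift.1 - (q.1 : ℤ)) / (k : ℤ)) *
        w ^ (((p.2.1 : ℤ) + e.shift.2 - (q.2.1 : ℤ)) / (l : ℤ))
    else 0

/-- The modified weighted adjacency (Kasteleyn) matrix `K(z, w)` of the toroidal graph. -/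
noncomputable def kasteleyn (W : Weights) (k l : ℕ) (z w : ℂ) :
    Matrix (TorusVertex k l) (TorusVertex k l) ℂ :=
  Matrix.of fun p q => forward W k l z w p q - forward W k l z⁻¹ w⁻¹ q p

/-- The characteristic polynomial `P(z, w) = det K(z, w)`. -/
noncomputable def charPoly (W : Weights) (k l : ℕ) (z w : ℂ) : ℂ :=
  (kasteleyn W k l z w).det

/-- The spectral curve: the zero locus of `P` among the pairs of nonzero complex numbers. -/
def spectralCurve (W : Weights) (k l : ℕ) : Set (ℂ × ℂ) :=
  {x | x.1 ≠ 0 ∧ x.2 ≠ 0 ∧ charPoly W k l x.1 x.2 = 0}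

/-- The unit torus `𝕋²`. -/
def unitTorus : Set (ℂ × ℂ) := {x | ‖x.1‖ = 1 ∧ ‖x.2‖ = 1}

end OneTwo

/-!
The determinant `P(z, w)` vanishes exactly when the Kasteleyn matrix has a nonzero kernel vector, so
the proof studies the linear system `K(z, w) ψ = 0` for `|z| = |w| = 1`.

All gadget edges have weight `1`, and the values of `ψ` at the vertices of the gadgets are explicit
linear functions of the values at `centre`, `port` and `link₃` (`gadget_black`, `gadget_white`).
What remains of each cell is a system of four equations (`Cell.IsSolution`, `isSolution`) in the
values `u`, `v` at the two centres, `p`, `q` at the two ports, and `L`, `M` at the two vertices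
`link₃`.  Consecutive cells are joined by the single edge `portport`, so the cells form a closed
chain: up to factors of modulus one, `L` is the value `q` of the preceding cell and `M` is minus the
value `p` of the following one (`link₃_black`, `link₃_white`).

If `w` is not real, `C.disc w > 0` and the equations of a cell express `L` and `M` through `p` and
`q`.  They give
`disc * (Im (conj q * M) - Im (conj p * L)) = 2 * Im w * (gain₁ * |p|² + gain₂ * |q|²)`
with positive `gain₁`, `gain₂` (`Cell.IsSolution.flux`).  The flux on the left is what leaves a cell
minus what enters it, so its sum over the closed chain is zero (`sum_flux_eq_zero`), and all `p` and
`q` vanish.  Hence so does `ψ`, and `P(z, w) ≠ 0`.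

If `w = ε = ±1`, the cell acts diagonally: `g L = Δ q` and `g M = -Δ p` with real `g` and `Δ`
(`Cell.IsSolution.realCoupling_mul`).  Multiplication along the chain yields `z ∏ (ε g) = ∏ Δ`
(`mul_prod_realCoupling_eq_prod_portDet`), so `z` is real and determined by `ε`.  Taking absolute
values gives `∏ |g| = ∏ |Δ|`.  This cannot hold for both signs: in each cell `|Δ(1)| < Δ(-1)` and
`|g(-1)| < g(1)`, so it would follow that
`∏ g(1) = ∏ |Δ(1)| < ∏ Δ(-1) = ∏ |g(-1)| ≤ ∏ g(1)`.
-/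

namespace OneTwo

open Colour Site EdgeType
open scoped ComplexConjugate

/-! ### The rows of the Kasteleyn matrix -/

/-- The phase that the edge from the port of cell `i` to the port of the preceding cell picks up:
`z⁻¹` if it crosses the boundary of the fundamental domain, `1` otherwise. -/
noncomputable def seam {n : ℕ} (z : ℂ) (i : Fin (n + 1)) : ℂ := if i = 0 then z⁻¹ else 1

theorem seam_inv {n : ℕ} (z : ℂ) (i : Fin (n + 1)) : seam z⁻¹ i = (seam z i)⁻¹ := by
  unfold seam; split_ifs <;> simp

theorem sum_edgeType (f : EdgeType → ℂ) :
    ∑ e, f e = (f (legA black) + f (legA white)) + (f (legB black) + f (legB white)) +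
      (f (legC black) + f (legC white)) + (f (triAB black) + f (triAB white)) +
      (f (triB1 black) + f (triB1 white)) + (f (tri1A black) + f (tri1A white)) +
      (f (link12 black) + f (link12 white)) + (f (triC2 black) + f (triC2 white)) +
      (f (triC3 black) + f (triC3 white)) + (f (tri32 black) + f (tri32 white)) +
      (f (link3p black) + f (link3p white)) + f portport := by
  have h : (Finset.univ : Finset EdgeType) = {legA black, legA white, legB black, legB white,
      legC black, legC white, triAB black, triAB white, triB1 black, triB1 white, tri1A black,
      tri1A white, link12 black, link12 white, triC2 black, triC2 white, triC3 black, triC3 white,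
      tri32 black, tri32 white, link3p black, link3p white, portport} := by
    decide
  rw [h]
  simp [Finset.sum_insert]
  ring

theorem shift_fst_eq_zero {e : EdgeType} (h : e ≠ portport) : e.shift.1 = 0 := by
  rcases e with (s|s|s|s|s|s|s|s|s|s|s|s) <;> try cases s
  all_goals first | rfl | exact absurd rfl h

theorem dvd_sub_val {n : ℕ} (i j : Fin (n + 1)) :
    ((n + 1 : ℕ) : ℤ) ∣ (i : ℤ) + 0 - (j : ℤ) ↔ j = i := by
  have hi := i.2
  have hj := j.2
  constructor
  · rintro ⟨c, hc⟩
    have h1 : c = 0 := by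
      have : c < 1 := by by_contra h; push Not at h; push_cast at *; nlinarith
      have : -1 < c := by by_contra h; push Not at h; push_cast at *; nlinarith
      omega
    subst h1
    ext; omega
  · rintro rfl; simp

/-- The edge `portport` leads from the cell `j + 1`, cyclically, to the cell `j`. -/
theorem dvd_pred_sub_val {n : ℕ} (i j : Fin (n + 1)) :
    ((n + 1 : ℕ) : ℤ) ∣ (i : ℤ) + -1 - (j : ℤ) ↔ i = j + 1 := by
  have hi := i.2
  have hj := j.2
  rw [Fin.ext_iff, Fin.val_add_one]
  constructor
  · rintro ⟨c, hc⟩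
    have : c < 1 := by by_contra h; push Not at h; push_cast at *; nlinarith
    have : -2 < c := by by_contra h; push Not at h; push_cast at *; nlinarith
    obtain rfl | rfl : c = 0 ∨ c = -1 := by omega
    · split_ifs with h
      · subst h; simp at hc; omega
      · omega
    · split_ifs with h
      · push_cast at hc; omega
      · exfalso; apply h; ext; simp; push_cast at hc; omega
  · split_ifs with h
    · subst h; intro h; rw [h]; exact ⟨-1, by simp; ring⟩
    · intro h; rw [h]; exact ⟨0, by simp⟩

theorem seam_add_one {n : ℕ} (z : ℂ) (j : Fin (n + 1)) :
    z ^ ((((j + 1 : Fin (n + 1)) : ℕ) + -1 - (j : ℤ)) / ((n + 1 : ℕ) : ℤ)) = seam z (j + 1) := by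
  unfold seam
  have hj := j.2
  have := Fin.val_add_one j
  split_ifs at this with h
  · subst h
    simp
    have : ((-1 - (n:ℤ)) / ((n:ℤ) + 1)) = -1 := by
      rw [show (-1 - (n:ℤ)) = (-1) * ((n:ℤ)+1) by ring]
      exact Int.mul_ediv_cancel _ (by omega)
    rw [this]; simp
  · rw [if_neg (by rw [Fin.ext_iff, this]; simp), this]; simp

theorem sum_torusVertex {n : ℕ} (f : TorusVertex (n + 1) 1 → ℂ) :
    ∑ q, f q = ∑ x : Colour × Site, ∑ j : Fin (n + 1), f (j, 0, x) := by
  rw [Fintype.sum_prod_type, Finset.sum_comm, Fintype.sum_prod_type, Fin.sum_univ_one]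

theorem sum_ite_head {n : ℕ} (ψ : TorusVertex (n + 1) 1 → ℂ) (y : Colour × Site) (P : Prop)
    [Decidable P] (a : Fin (n + 1) → Prop) [DecidablePred a] (c : Fin (n + 1) → ℂ) :
    ∑ x : Colour × Site, ∑ j : Fin (n + 1),
      (if P ∧ y = x ∧ a j then c j else 0) * ψ (j, 0, x) =
    if P then ∑ j, (if a j then c j * ψ (j, 0, y) else 0) else 0 := by
  by_cases hP : P
  · rw [Finset.sum_eq_single y]
    · simp [hP, ite_mul]
    · intro b _ hb
      simp [hP, hb.symm]
    · simp
  · simp [hP]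

/-- The part of a row of the Kasteleyn system that comes from the edges leaving the vertex: only
`portport` leads to another cell, and only its weight carries a power of `z`. -/
theorem sum_forward {n : ℕ} (W : Weights) (z w : ℂ) (ψ : TorusVertex (n + 1) 1 → ℂ)
    (i : Fin (n + 1)) (x : Colour × Site) :
    ∑ q, forward W (n + 1) 1 z w (i, 0, x) q * ψ q =
      ∑ e : EdgeType, if e.tail = x then (e.weight W i 0 : ℂ) * w ^ e.shift.2 *
        (if e = portport then seam z i * ψ (i - 1, 0, e.head) else ψ (i, 0, e.head)) else 0 := by
  rw [sum_torusVertex]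
  simp only [forward, Finset.sum_mul]
  have : ∀ f : Colour × Site → Fin (n+1) → EdgeType → ℂ,
      ∑ x, ∑ j, ∑ e, f x j e = ∑ e, ∑ x, ∑ j, f x j e := by
    intro f
    simp_rw [Finset.sum_comm (s := (Finset.univ : Finset (Fin (n+1))))]
    rw [Finset.sum_comm]
  rw [this]
  refine Finset.sum_congr rfl fun e _ => ?_
  simp only [sum_ite_head]
  split_ifs with h1 h2
  · subst h2
    rw [Finset.sum_eq_single (i - 1)]
    · have := (dvd_pred_sub_val i (i-1)).2 (by simp)
      rw [if_pos ⟨by simpa [EdgeType.shift] using this, by simp⟩]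
      have h := seam_add_one z (i - 1)
      rw [sub_add_cancel] at h
      simp only [EdgeType.shift, ← h]
      simp
      ring
    · intro j _ hj
      rw [if_neg]
      rintro ⟨h, -⟩
      exact hj (by rw [(dvd_pred_sub_val i j).1 h]; simp)
    · simp
  · have hs := shift_fst_eq_zero h2
    rw [Finset.sum_eq_single i]
    · rw [if_pos ⟨by rw [hs]; simp, by simp⟩, hs]
      simp
    · intro j _ hj
      rw [if_neg]
      rintro ⟨h, -⟩
      rw [hs] at h
      exact hj ((dvd_sub_val i j).1 h)
    · simp
  · rfl

theorem sum_ite_tail {n : ℕ} (ψ : TorusVertex (n + 1) 1 → ℂ) (y : Colour × Site) (P : Prop)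
    [Decidable P] (a : Fin (n + 1) → Prop) [DecidablePred a] (c : Fin (n + 1) → ℂ) :
    ∑ x : Colour × Site, ∑ j : Fin (n + 1),
      (if y = x ∧ P ∧ a j then c j else 0) * ψ (j, 0, x) =
    if P then ∑ j, (if a j then c j * ψ (j, 0, y) else 0) else 0 := by
  simp only [and_left_comm (b := P)]
  exact sum_ite_head ψ y P a c

/-- The part of a row of the Kasteleyn system that comes from the edges entering the vertex, up to
sign and inversion of `z` and `w`.  For `portport` the tail lies in the cell `i + 1`; writing its
weight with index `i` is harmless, as it is `1`. -/
theorem sum_forward_transpose {n : ℕ} (W : Weights) (z w : ℂ) (ψ : TorusVertex (n + 1) 1 → ℂ)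
    (i : Fin (n + 1)) (x : Colour × Site) :
    ∑ q, forward W (n + 1) 1 z w q (i, 0, x) * ψ q =
      ∑ e : EdgeType, if e.head = x then (e.weight W i 0 : ℂ) * w ^ e.shift.2 *
        (if e = portport then seam z (i + 1) * ψ (i + 1, 0, e.tail) else ψ (i, 0, e.tail))
        else 0 := by
  rw [sum_torusVertex]
  simp only [forward, Finset.sum_mul]
  have : ∀ f : Colour × Site → Fin (n+1) → EdgeType → ℂ,
      ∑ x, ∑ j, ∑ e, f x j e = ∑ e, ∑ x, ∑ j, f x j e := by
    intro f
    simp_rw [Finset.sum_comm (s := (Finset.univ : Finset (Fin (n+1))))]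
    rw [Finset.sum_comm]
  rw [this]
  refine Finset.sum_congr rfl fun e _ => ?_
  simp only [sum_ite_tail]
  split_ifs with h1 h2
  · subst h2
    rw [Finset.sum_eq_single (i + 1)]
    · have := (dvd_pred_sub_val (i + 1) i).2 rfl
      rw [if_pos ⟨by simpa [EdgeType.shift] using this, by simp⟩]
      simp only [EdgeType.shift, ← seam_add_one z i]
      simp [EdgeType.weight]
      ring
    · intro j _ hj
      rw [if_neg]
      rintro ⟨h, -⟩
      exact hj ((dvd_pred_sub_val j i).1 h)
    · simp
  · have hs := shift_fst_eq_zero h2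
    rw [Finset.sum_eq_single i]
    · rw [if_pos ⟨by rw [hs]; simp, by simp⟩, hs]
      simp
    · intro j _ hj
      rw [if_neg]
      rintro ⟨h, -⟩
      rw [hs] at h
      exact hj ((dvd_sub_val j i).1 h).symm
    · simp
  · rfl

theorem kasteleyn_mulVec_apply {n : ℕ} (W : Weights) (z w : ℂ) (ψ : TorusVertex (n + 1) 1 → ℂ)
    (i : Fin (n + 1)) (x : Colour × Site) :
    (kasteleyn W (n + 1) 1 z w).mulVec ψ (i, 0, x) =
      (∑ e : EdgeType, if e.tail = x then (e.weight W i 0 : ℂ) * w ^ e.shift.2 *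
        (if e = portport then seam z i * ψ (i - 1, 0, e.head) else ψ (i, 0, e.head)) else 0) -
      ∑ e : EdgeType, if e.head = x then (e.weight W i 0 : ℂ) * w⁻¹ ^ e.shift.2 *
        (if e = portport then (seam z (i + 1))⁻¹ * ψ (i + 1, 0, e.tail) else ψ (i, 0, e.tail))
        else 0 := by
  rw [← sum_forward, ← seam_inv, ← sum_forward_transpose, ← Finset.sum_sub_distrib]
  simp only [Matrix.mulVec, dotProduct, kasteleyn, Matrix.of_apply, sub_mul]

/-! ### The reduced equations of one cell -/

/-- The local weights `(a₁, b₁, c₁)` of the black and `(a₂, b₂, c₂)` of the white vertex of one cell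
of the hexagonal lattice. -/
structure Cell where
  a₁ : ℝ
  b₁ : ℝ
  c₁ : ℝ
  a₂ : ℝ
  b₂ : ℝ
  c₂ : ℝ

namespace Cell

/-- All six local weights of the cell are strictly positive. -/
def IsPositive (C : Cell) : Prop :=
  (0 < C.a₁ ∧ 0 < C.b₁ ∧ 0 < C.c₁) ∧ 0 < C.a₂ ∧ 0 < C.b₂ ∧ 0 < C.c₂

/-- The equations that remain of the Kasteleyn system in one cell once the gadgets are eliminated,
for `|w| = 1`.  The unknowns are the values `u`, `v` at the black and the white centre, `p`, `q` at
the black and the white port, and `L`, `M` at the black and the white `link₃`. -/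
structure IsSolution (C : Cell) (w u v p q L M : ℂ) : Prop where
  centre₁ : -(C.b₁ * C.c₁ * (w - conj w)) * u +
    (C.a₂ * (C.b₁ + C.c₁ * conj w) + C.a₁ * (C.b₂ + C.c₂ * conj w)) * v +
    (C.c₁ * conj w - C.b₁) * p + C.a₁ * q = 0
  centre₂ : -(C.a₂ * (C.b₁ + C.c₁ * w) + C.a₁ * (C.b₂ + C.c₂ * w)) * u +
    C.b₂ * C.c₂ * (w - conj w) * v - C.a₂ * p + (C.c₂ * w - C.b₂) * q = 0
  port₁ : L = (C.c₁ * w - C.b₁) * u - C.a₂ * v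
  port₂ : M = C.a₁ * u + (C.c₂ * conj w - C.b₂) * v

variable {C : Cell} {w u v p q L M : ℂ}

/-- The coefficient that couples the two centres in the reduced equations. -/
noncomputable def coupling (C : Cell) (w : ℂ) : ℂ :=
  C.a₂ * (C.b₁ + C.c₁ * w) + C.a₁ * (C.b₂ + C.c₂ * w)

/-- The determinant of the equations `centre₁`, `centre₂` of `IsSolution` in the unknowns `u`, `v`;
it is real, by `ofReal_disc`. -/
noncomputable def disc (C : Cell) (w : ℂ) : ℝ :=
  Complex.normSq (C.coupling w) + C.b₁ * C.c₁ * (C.b₂ * C.c₂) * (2 * w.im) ^ 2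

theorem ofReal_disc (C : Cell) (w : ℂ) : (C.disc w : ℂ) =
    C.coupling w * conj (C.coupling w) - C.b₁ * C.c₁ * (C.b₂ * C.c₂) * (w - conj w) ^ 2 := by
  rw [disc, Complex.mul_conj, Complex.sub_conj]
  push_cast
  linear_combination (C.b₁ * C.c₁ * (C.b₂ * C.c₂) * (2 * w.im) ^ 2 : ℂ) * Complex.I_sq

theorem disc_pos (hC : C.IsPositive) (hw : w.im ≠ 0) : 0 < C.disc w := by
  obtain ⟨⟨_, _, _⟩, _, _, _⟩ := hC
  have := Complex.normSq_nonneg (C.coupling w)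
  unfold disc
  positivity

/-- Up to the factor `2 * w.im`, the coefficient of `|p|²` in `disc` times the flux that the
cell produces. -/
noncomputable def gain₁ (C : Cell) (w : ℂ) : ℝ :=
  C.b₂ * C.c₂ * Complex.normSq (C.c₁ * w - C.b₁) + C.a₂ ^ 2 * (C.b₁ * C.c₁) +
    C.a₁ * C.a₂ * (C.c₁ * C.b₂ + C.b₁ * C.c₂)

/-- Up to the factor `2 * w.im`, the coefficient of `|q|²` in `disc` times the flux that the
cell produces. -/
noncomputable def gain₂ (C : Cell) (w : ℂ) : ℝ :=
  C.b₁ * C.c₁ * Complex.normSq (C.c₂ * w - C.b₂) + C.a₁ ^ 2 * (C.b₂ * C.c₂) +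
    C.a₁ * C.a₂ * (C.c₁ * C.b₂ + C.b₁ * C.c₂)

theorem gain₁_pos (hC : C.IsPositive) : 0 < C.gain₁ w := by
  obtain ⟨⟨_, _, _⟩, _, _, _⟩ := hC
  have := Complex.normSq_nonneg (C.c₁ * w - C.b₁)
  unfold gain₁
  positivity

theorem gain₂_pos (hC : C.IsPositive) : 0 < C.gain₂ w := by
  obtain ⟨⟨_, _, _⟩, _, _, _⟩ := hC
  have := Complex.normSq_nonneg (C.c₂ * w - C.b₂)
  unfold gain₂
  positivity

/-- The coefficient of `q` in `disc * L`.  It may vanish, in which case the cell has no transfer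
matrix; for this reason `L` and `M` are expressed through `p` and `q`, and not `q` and `M` through
`p` and `L`. -/
noncomputable def transmission (C : Cell) (w : ℂ) : ℂ :=
  (C.c₁ * w - C.b₁) *
      (conj (C.coupling w) * (C.c₂ * w - C.b₂) - C.a₁ * (C.b₂ * C.c₂) * (w - conj w)) +
    C.a₂ * (C.a₁ * C.coupling w - C.b₁ * C.c₁ * (w - conj w) * (C.c₂ * w - C.b₂))

/-- Cramer's rule for `u` and `v` in `centre₁`, `centre₂`, inserted into `port₁`. -/
theorem IsSolution.disc_mul_left (h : C.IsSolution w u v p q L M) :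
    C.disc w * L = C.transmission w * q - (w - conj w) * C.gain₁ w * p := by
  obtain ⟨h1, h2, rfl, rfl⟩ := h
  rw [ofReal_disc, transmission, gain₁]
  push_cast
  rw [Complex.normSq_eq_conj_mul_self]
  simp only [coupling, map_add, map_sub, map_mul, Complex.conj_ofReal]
  linear_combination (C.c₁ * w - C.b₁) * (C.b₂ * C.c₂ * (w - conj w) * h1 -
    (C.a₂ * (C.b₁ + C.c₁ * conj w) + C.a₁ * (C.b₂ + C.c₂ * conj w)) * h2) -
    C.a₂ * ((C.a₂ * (C.b₁ + C.c₁ * w) + C.a₁ * (C.b₂ + C.c₂ * w)) * h1 -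
      C.b₁ * C.c₁ * (w - conj w) * h2)

/-- Cramer's rule for `u` and `v` in `centre₁`, `centre₂`, inserted into `port₂`. -/
theorem IsSolution.disc_mul_right (h : C.IsSolution w u v p q L M) :
    C.disc w * M = -(conj (C.transmission w) * p) + (w - conj w) * C.gain₂ w * q := by
  obtain ⟨h1, h2, rfl, rfl⟩ := h
  rw [ofReal_disc, transmission, gain₂]
  push_cast
  rw [Complex.normSq_eq_conj_mul_self]
  simp only [coupling, map_add, map_sub, map_mul, Complex.conj_ofReal, Complex.conj_conj]
  linear_combination C.a₁ * (C.b₂ * C.c₂ * (w - conj w) * h1 -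
    (C.a₂ * (C.b₁ + C.c₁ * conj w) + C.a₁ * (C.b₂ + C.c₂ * conj w)) * h2) +
    (C.c₂ * conj w - C.b₂) * ((C.a₂ * (C.b₁ + C.c₁ * w) + C.a₁ * (C.b₂ + C.c₂ * w)) * h1 -
      C.b₁ * C.c₁ * (w - conj w) * h2)

/-- The difference of the fluxes at the two ends of a cell is definite, with the sign of `w.im`: the
terms with `transmission` in `disc_mul_left` and `disc_mul_right` only contribute to the real part
of `conj q * M - conj p * L`. -/
theorem IsSolution.flux (h : C.IsSolution w u v p q L M) :
    C.disc w * ((conj q * M).im - (conj p * L).im) =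
      2 * w.im * (C.gain₁ w * Complex.normSq p + C.gain₂ w * Complex.normSq q) := by
  have key : C.disc w * (conj q * M - conj p * L) =
      -(C.transmission w * q * conj p + conj (C.transmission w * q * conj p)) +
      ((2 * w.im * (C.gain₁ w * Complex.normSq p + C.gain₂ w * Complex.normSq q) : ℝ) : ℂ) *
        Complex.I := by
    push_cast
    rw [Complex.normSq_eq_conj_mul_self, Complex.normSq_eq_conj_mul_self]
    simp only [map_mul, Complex.conj_conj]
    have hs := Complex.sub_conj w
    push_cast at hs
    linear_combination conj q * h.disc_mul_right - conj p * h.disc_mul_left +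
      (C.gain₁ w * (conj p * p) + C.gain₂ w * (conj q * q)) * hs
  have := congrArg Complex.im key
  rw [Complex.add_conj] at this
  simpa only [Complex.add_im, Complex.neg_im, Complex.ofReal_im, Complex.sub_im,
    Complex.im_ofReal_mul, Complex.I_im, mul_one, neg_zero, zero_add] using this

theorem IsSolution.eq_zero (hC : C.IsPositive) (hw : w.im ≠ 0)
    (h : C.IsSolution w u v 0 0 L M) : u = 0 ∧ v = 0 := by
  obtain ⟨h1, h2, -, -⟩ := h
  have hd : (C.disc w : ℂ) ≠ 0 := by exact_mod_cast (disc_pos hC hw).ne'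
  have hd' := ofReal_disc C w
  simp only [coupling, map_add, map_mul, Complex.conj_ofReal] at hd'
  constructor <;> refine (mul_eq_zero.1 ?_).resolve_left hd <;> rw [hd']
  · linear_combination (C.b₂ * C.c₂ * (w - conj w) * h1 -
      (C.a₂ * (C.b₁ + C.c₁ * conj w) + C.a₁ * (C.b₂ + C.c₂ * conj w)) * h2)
  · linear_combination ((C.a₂ * (C.b₁ + C.c₁ * w) + C.a₁ * (C.b₂ + C.c₂ * w)) * h1 -
      C.b₁ * C.c₁ * (w - conj w) * h2)

/-- For real `w = ε`, the determinant of `(u, v) ↦ (L, M)`. -/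
noncomputable def portDet (C : Cell) (ε : ℝ) : ℝ :=
  (C.c₁ * ε - C.b₁) * (C.c₂ * ε - C.b₂) + C.a₁ * C.a₂

/-- `coupling` at a real point, as a real number. -/
noncomputable def realCoupling (C : Cell) (ε : ℝ) : ℝ :=
  C.a₂ * (C.b₁ + C.c₁ * ε) + C.a₁ * (C.b₂ + C.c₂ * ε)

/-- At a real point the cell does not mix the two ends: `L` depends on `q` only and `M` on `p`. -/
theorem IsSolution.realCoupling_mul {ε : ℝ} (h : C.IsSolution ε u v p q L M) :
    C.realCoupling ε * L = C.portDet ε * q ∧ C.realCoupling ε * M = -(C.portDet ε * p) := by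
  obtain ⟨h1, h2, rfl, rfl⟩ := h
  simp only [Complex.conj_ofReal] at *
  simp only [realCoupling, portDet]
  push_cast
  constructor
  · linear_combination -(C.c₁ * ε - C.b₁ : ℂ) * h2 - C.a₂ * h1
  · linear_combination -(C.a₁ : ℂ) * h2 + (C.c₂ * ε - C.b₂ : ℂ) * h1

theorem IsSolution.eq_zero_of_real {ε : ℝ} (hε : C.realCoupling ε ≠ 0 ∨ C.portDet ε ≠ 0)
    (h : C.IsSolution ε u v 0 0 0 0) : u = 0 ∧ v = 0 := by
  obtain ⟨h1, h2, h3, h4⟩ := h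
  simp only [Complex.conj_ofReal] at *
  rcases hε with hε | hε
  · have hε' : (C.realCoupling ε : ℂ) ≠ 0 := by exact_mod_cast hε
    constructor <;> refine (mul_eq_zero.1 ?_).resolve_left hε' <;>
      simp only [realCoupling] <;> push_cast
    · linear_combination -h2
    · linear_combination h1
  · have hε' : (C.portDet ε : ℂ) ≠ 0 := by exact_mod_cast hε
    constructor <;> refine (mul_eq_zero.1 ?_).resolve_left hε' <;> simp only [portDet] <;> push_cast
    · linear_combination -(C.c₂ * ε - C.b₂ : ℂ) * h3 - C.a₂ * h4
    · linear_combination -(C.c₁ * ε - C.b₁ : ℂ) * h4 + C.a₁ * h3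

theorem realCoupling_one_pos (hC : C.IsPositive) : 0 < C.realCoupling 1 := by
  obtain ⟨⟨_, _, _⟩, _, _, _⟩ := hC
  unfold realCoupling; positivity

theorem portDet_neg_one_pos (hC : C.IsPositive) : 0 < C.portDet (-1) := by
  obtain ⟨⟨_, _, _⟩, _, _, _⟩ := hC
  have : C.portDet (-1) = (C.c₁ + C.b₁) * (C.c₂ + C.b₂) + C.a₁ * C.a₂ := by unfold portDet; ring
  rw [this]; positivity

theorem abs_portDet_one_lt (hC : C.IsPositive) : |C.portDet 1| < C.portDet (-1) := by
  obtain ⟨⟨h1, h2, h3⟩, h4, h5, h6⟩ := hC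
  have := mul_pos h1 h4
  have := mul_pos h2 h5
  have := mul_pos h2 h6
  have := mul_pos h3 h5
  have := mul_pos h3 h6
  rw [abs_lt]
  constructor <;> unfold portDet <;> nlinarith

theorem abs_realCoupling_neg_one_lt (hC : C.IsPositive) :
    |C.realCoupling (-1)| < C.realCoupling 1 := by
  obtain ⟨⟨h1, h2, h3⟩, h4, h5, h6⟩ := hC
  have := mul_pos h4 h2
  have := mul_pos h4 h3
  have := mul_pos h1 h5
  have := mul_pos h1 h6
  rw [abs_lt]
  constructor <;> unfold realCoupling <;> nlinarith

end Cell

/-! ### Elimination of the gadgets -/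

/-- The local weights in the cell `(m, 0)`. -/
def Weights.cell (W : Weights) (m : ℤ) : Cell where
  a₁ := W.a m 0 black
  b₁ := W.b m 0 black
  c₁ := W.c m 0 black
  a₂ := W.a m 0 white
  b₂ := W.b m 0 white
  c₂ := W.c m 0 white

theorem Weights.IsPositive.cell {W : Weights} (hW : W.IsPositive) (m : ℤ) :
    (W.cell m).IsPositive :=
  ⟨hW m 0 black, hW m 0 white⟩

variable {n : ℕ} {W : Weights} {z w : ℂ} {ψ : TorusVertex (n + 1) 1 → ℂ}

theorem row_eq_zero (h : (kasteleyn W (n + 1) 1 z w).mulVec ψ = 0) (i : Fin (n + 1))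
    (x : Colour × Site) :
    (∑ e : EdgeType, if e.tail = x then (e.weight W i 0 : ℂ) * w ^ e.shift.2 *
        (if e = portport then seam z i * ψ (i - 1, 0, e.head) else ψ (i, 0, e.head)) else 0) -
      (∑ e : EdgeType, if e.head = x then (e.weight W i 0 : ℂ) * w⁻¹ ^ e.shift.2 *
        (if e = portport then (seam z (i + 1))⁻¹ * ψ (i + 1, 0, e.tail) else ψ (i, 0, e.tail))
        else 0) = 0 := by
  rw [← kasteleyn_mulVec_apply, h]; rfl

theorem link₃_black (h : (kasteleyn W (n + 1) 1 z w).mulVec ψ = 0) (i : Fin (n + 1)) :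
    ψ (i, 0, black, link₃) = w * (seam z i * ψ (i - 1, 0, white, port)) := by
  have h1 := row_eq_zero h i (black, port)
  simp [sum_edgeType, EdgeType.tail, EdgeType.head, EdgeType.weight, EdgeType.shift] at h1
  linear_combination -h1

theorem link₃_white (h : (kasteleyn W (n + 1) 1 z w).mulVec ψ = 0) (i : Fin (n + 1)) :
    ψ (i, 0, white, link₃) = -(w⁻¹ * ((seam z (i + 1))⁻¹ * ψ (i + 1, 0, black, port))) := by
  have h1 := row_eq_zero h i (white, port)
  simp [sum_edgeType, EdgeType.tail, EdgeType.head, EdgeType.weight, EdgeType.shift] at h1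
  linear_combination -h1

/-- The values of a kernel vector at the gadget vertices labelled by a black vertex of the hexagonal
lattice are determined by those at its `centre`, `port` and `link₃`.  The `endA` tied to them by a
triangle is the one of the white vertex. -/
theorem gadget_black (h : (kasteleyn W (n + 1) 1 z w).mulVec ψ = 0)
    (i : Fin (n + 1)) :
    let C := W.cell i
    let u := ψ (i, 0, black, centre)
    let p := ψ (i, 0, black, port)
    let L := ψ (i, 0, black, link₃)
    ψ (i, 0, black, link₂) = C.c₁ * w * u - L ∧
    ψ (i, 0, black, endC) = C.c₁ * w * u - L + p ∧
    ψ (i, 0, black, link₁) = -(C.c₁ * w * u) - p ∧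
    ψ (i, 0, white, endA) = -((C.c₁ * w + C.b₁) * u) - p ∧
    ψ (i, 0, black, endB) = -(C.b₁ * u) - p - L := by
  have hB := row_eq_zero h i (black, endB)
  have hC := row_eq_zero h i (black, endC)
  have h₁ := row_eq_zero h i (black, link₁)
  have h₂ := row_eq_zero h i (black, link₂)
  have h₃ := row_eq_zero h i (black, link₃)
  simp [sum_edgeType, EdgeType.tail, EdgeType.head, EdgeType.weight, EdgeType.shift,
    Colour.swap] at hB hC h₁ h₂ h₃
  simp only [Weights.cell]
  refine ⟨?_, ?_, ?_, ?_, ?_⟩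
  · linear_combination hC
  · linear_combination hC - h₃
  · linear_combination h₃ - h₂ - hC
  · linear_combination h₃ - h₂ - hC - hB
  · linear_combination h₃ - h₂ - hB - h₁

/-- The same as `gadget_black` with the colours exchanged, which replaces `w` by `w⁻¹ = conj w`. -/
theorem gadget_white (hw : ‖w‖ = 1) (h : (kasteleyn W (n + 1) 1 z w).mulVec ψ = 0)
    (i : Fin (n + 1)) :
    let C := W.cell i
    let v := ψ (i, 0, white, centre)
    let q := ψ (i, 0, white, port)
    let M := ψ (i, 0, white, link₃)
    ψ (i, 0, white, link₂) = C.c₂ * conj w * v - M ∧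
    ψ (i, 0, white, endC) = C.c₂ * conj w * v - M + q ∧
    ψ (i, 0, white, link₁) = -(C.c₂ * conj w * v) - q ∧
    ψ (i, 0, black, endA) = -((C.c₂ * conj w + C.b₂) * v) - q ∧
    ψ (i, 0, white, endB) = -(C.b₂ * v) - q - M := by
  have hB := row_eq_zero h i (white, endB)
  have hC := row_eq_zero h i (white, endC)
  have h₁ := row_eq_zero h i (white, link₁)
  have h₂ := row_eq_zero h i (white, link₂)
  have h₃ := row_eq_zero h i (white, link₃)
  simp [sum_edgeType, EdgeType.tail, EdgeType.head, EdgeType.weight, EdgeType.shift,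
    Colour.swap] at hB hC h₁ h₂ h₃
  rw [← Complex.inv_eq_conj hw]
  simp only [Weights.cell]
  refine ⟨?_, ?_, ?_, ?_, ?_⟩
  · linear_combination hC
  · linear_combination hC - h₃
  · linear_combination h₃ - h₂ - hC
  · linear_combination h₃ - h₂ - hC - hB
  · linear_combination h₃ - h₂ - hB - h₁

theorem isSolution (hw : ‖w‖ = 1) (h : (kasteleyn W (n + 1) 1 z w).mulVec ψ = 0)
    (i : Fin (n + 1)) :
    (W.cell i).IsSolution w (ψ (i, 0, black, centre)) (ψ (i, 0, white, centre))
      (ψ (i, 0, black, port)) (ψ (i, 0, white, port))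
      (ψ (i, 0, black, link₃)) (ψ (i, 0, white, link₃)) := by
  obtain ⟨-, eC, e1, eA, eB⟩ := gadget_black h i
  obtain ⟨-, fC, f1, fA, fB⟩ := gadget_white hw h i
  have h1 := row_eq_zero h i (black, centre)
  have h2 := row_eq_zero h i (white, centre)
  have h3 := row_eq_zero h i (black, endA)
  have h4 := row_eq_zero h i (white, endA)
  simp [sum_edgeType, EdgeType.tail, EdgeType.head, EdgeType.weight, EdgeType.shift,
    Colour.swap] at h1 h2 h3 h4
  rw [Complex.inv_eq_conj hw] at h1
  rw [eB, eC, fA] at h1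
  rw [fB, fC, eA] at h2
  rw [fB, f1] at h3
  rw [eB, e1] at h4
  simp only [Weights.cell] at *
  have k1 : ψ (i, 0, black, link₃) = (W.c i 0 black * w - W.b i 0 black) * ψ (i, 0, black, centre) -
    W.a i 0 white * ψ (i, 0, white, centre) := by linear_combination -h4
  have k2 : ψ (i, 0, white, link₃) = W.a i 0 black * ψ (i, 0, black, centre) +
    (W.c i 0 white * conj w - W.b i 0 white) * ψ (i, 0, white, centre) := by linear_combination -h3
  refine ⟨?_, ?_, k1, k2⟩
  · simp only
    linear_combination h1 + (W.b i 0 black + W.c i 0 black * conj w : ℂ) * k1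
  · simp only
    linear_combination h2 + (W.b i 0 white + W.c i 0 white * w : ℂ) * k2

/-- A kernel vector that vanishes at all centres and ports vanishes. -/
theorem eq_zero_of_centre_of_port (hw : ‖w‖ = 1) (h : (kasteleyn W (n + 1) 1 z w).mulVec ψ = 0)
    (hc : ∀ i s, ψ (i, 0, s, centre) = 0) (hp : ∀ i s, ψ (i, 0, s, port) = 0) : ψ = 0 := by
  ext ⟨i, j, s, x⟩
  obtain rfl : j = 0 := Subsingleton.elim _ _
  have h1 := gadget_black h i
  have h2 := gadget_white hw h i
  simp only [link₃_black h i, link₃_white h i, hc, hp, mul_zero, sub_zero, neg_zero,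
    add_zero] at h1 h2
  have h3 := link₃_black h i
  have h4 := link₃_white h i
  simp only [hp, mul_zero, neg_zero] at h3 h4
  cases s <;> cases x <;> simp [hc, hp, h1, h2, h3, h4]

theorem sum_add_one (f : Fin (n + 1) → ℝ) : ∑ i, f (i + 1) = ∑ i, f i :=
  Equiv.sum_comp (Equiv.addRight (1 : Fin (n + 1))) f

theorem prod_add_one (f : Fin (n + 1) → ℂ) : ∏ i, f (i + 1) = ∏ i, f i :=
  Equiv.prod_comp (Equiv.addRight (1 : Fin (n + 1))) f

/-- The flux leaving a cell at its white port is the flux entering the next one at its black port,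
so the differences add up to zero along the closed chain of cells. -/
theorem sum_flux_eq_zero (hz : ‖z‖ = 1) (hw : ‖w‖ = 1)
    (h : (kasteleyn W (n + 1) 1 z w).mulVec ψ = 0) :
    ∑ i, ((conj (ψ (i, 0, white, port)) * ψ (i, 0, white, link₃)).im -
      (conj (ψ (i, 0, black, port)) * ψ (i, 0, black, link₃)).im) = 0 := by
  rw [Finset.sum_sub_distrib, sub_eq_zero, ← sum_add_one
    (fun i => (conj (ψ (i, 0, black, port)) * ψ (i, 0, black, link₃)).im)]
  refine Finset.sum_congr rfl fun i _ => ?_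
  have hs : ‖seam z (i + 1)‖ = 1 := by unfold seam; split_ifs <;> simp [hz]
  rw [link₃_white h, link₃_black h, add_sub_cancel_right,
    Complex.inv_eq_conj hw, Complex.inv_eq_conj hs]
  rw [← neg_neg (Complex.im (_ * (w * _))), ← Complex.conj_im, ← Complex.neg_im]
  congr 1
  simp only [map_mul, Complex.conj_conj]
  ring

/-! ### Points with non-real second coordinate -/

theorem charPoly_ne_zero_of_im_ne_zero (hW : W.IsPositive) (hz : ‖z‖ = 1) (hw : ‖w‖ = 1)
    (him : w.im ≠ 0) : charPoly W (n + 1) 1 z w ≠ 0 := by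
  intro h0
  obtain ⟨ψ, hψ, h⟩ := Matrix.exists_mulVec_eq_zero_iff.2 h0
  apply hψ
  have hflux := sum_flux_eq_zero hz hw h
  set F : Fin (n + 1) → ℝ := fun i => (conj (ψ (i, 0, white, port)) * ψ (i, 0, white, link₃)).im -
      (conj (ψ (i, 0, black, port)) * ψ (i, 0, black, link₃)).im with hF
  have hcell : ∀ i : Fin (n + 1), (W.cell i).disc w * (w.im * F i) = 2 * w.im ^ 2 *
      ((W.cell i).gain₁ w * Complex.normSq (ψ (i, 0, black, port)) +
        (W.cell i).gain₂ w * Complex.normSq (ψ (i, 0, white, port))) := fun i => by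
    linear_combination w.im * (isSolution hw h i).flux
  have hdisc (i : Fin (n + 1)) := Cell.disc_pos (hW.cell i) him
  have h₁ (i : Fin (n + 1)) := Cell.gain₁_pos (w := w) (hW.cell i)
  have h₂ (i : Fin (n + 1)) := Cell.gain₂_pos (w := w) (hW.cell i)
  have hnn (i : Fin (n + 1)) (s : Colour) := Complex.normSq_nonneg (ψ (i, 0, s, port))
  have hF0 : ∀ i, 0 ≤ w.im * F i := fun i => by
    refine nonneg_of_mul_nonneg_right ?_ (hdisc i)
    rw [hcell]
    have := h₁ i; have := h₂ i; have := hnn i black; have := hnn i white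
    positivity
  have hF1 : ∀ i, w.im * F i = 0 := fun i =>
    (Finset.sum_eq_zero_iff_of_nonneg fun i _ => hF0 i).1
      (by rw [← Finset.mul_sum, hflux, mul_zero]) i (Finset.mem_univ i)
  have hport : ∀ i s, ψ (i, 0, s, port) = 0 := fun i => by
    have e := hcell i
    rw [hF1, mul_zero, eq_comm, mul_eq_zero_iff_left (by positivity),
      add_eq_zero_iff_of_nonneg (mul_nonneg (h₁ i).le (hnn i _)) (mul_nonneg (h₂ i).le (hnn i _)),
      mul_eq_zero_iff_left (h₁ i).ne', mul_eq_zero_iff_left (h₂ i).ne',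
      Complex.normSq_eq_zero, Complex.normSq_eq_zero] at e
    rintro (_ | _)
    exacts [e.1, e.2]
  refine eq_zero_of_centre_of_port hw h (fun i => ?_) hport
  have hs := isSolution hw h i
  rw [hport, hport] at hs
  obtain ⟨hu, hv⟩ := hs.eq_zero (hW.cell i) him
  rintro (_ | _)
  exacts [hu, hv]

/-! ### Real points of the spectral curve -/

open Fin.CommRing in
/-- A nonzero solution of a cyclic first order recursion has no zeros, provided that the recursion
can be solved in one direction, and then the product of the equations is the closing condition. -/
theorem prod_eq_prod_of_cyclic {φ α β : Fin (n + 1) → ℂ}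
    (h : ∀ i, α i * φ (i + 1) = β i * φ i) (hne : (∀ i, α i ≠ 0) ∨ ∀ i, β i ≠ 0)
    (hφ : ∃ i, φ i ≠ 0) : ∏ i, α i = ∏ i, β i := by
  have hall : ∀ i, φ i ≠ 0 := by
    by_contra! hex
    obtain ⟨i, hi⟩ := hex
    obtain ⟨j, hj⟩ := hφ
    rcases hne with hα | hβ
    · have hm : ∀ m : ℕ, φ (i + (m : Fin (n + 1))) = 0 := by
        intro m
        induction m with
        | zero => simpa using hi
        | succ m ih =>
          have := h (i + (m : Fin (n + 1)))
          rw [ih, mul_zero, mul_eq_zero_iff_left (hα _)] at this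
          rwa [Nat.cast_succ, ← add_assoc]
      apply hj
      have := hm (j - i).val
      rwa [Fin.cast_val_eq_self, add_sub_cancel] at this
    · have hm : ∀ m : ℕ, φ (i - (m : Fin (n + 1))) = 0 := by
        intro m
        induction m with
        | zero => simpa using hi
        | succ m ih =>
          have := h (i - ((m + 1 : ℕ) : Fin (n + 1)))
          rw [Nat.cast_succ, ← sub_sub, sub_add_cancel, ih, mul_zero, eq_comm,
            mul_eq_zero_iff_left (hβ _)] at this
          rwa [Nat.cast_succ, ← sub_sub]
      apply hj
      have := hm (i - j).val
      rwa [Fin.cast_val_eq_self, sub_sub_cancel] at this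
  have hprod := Finset.prod_congr (rfl : (Finset.univ : Finset (Fin (n + 1))) = _)
    fun i _ => h i
  rw [Finset.prod_mul_distrib, Finset.prod_mul_distrib, prod_add_one φ] at hprod
  exact mul_right_cancel₀ (Finset.prod_ne_zero_iff.2 fun i _ => hall i) hprod

theorem prod_seam (z : ℂ) : ∏ i : Fin (n + 1), seam z i = z⁻¹ := by
  simp [seam]

/-- The closing condition of the chain of cells for `w = ε = ±1`.  The black and the white ports
give the recursions in the two directions, and hence the same condition up to complex
conjugation. -/
theorem mul_prod_realCoupling_eq_prod_portDet {ε : ℝ} (hε : ε ^ 2 = 1)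
    (hne : (∀ i : Fin (n + 1), (W.cell i).realCoupling ε ≠ 0) ∨
      ∀ i : Fin (n + 1), (W.cell i).portDet ε ≠ 0)
    (hz : ‖z‖ = 1) (h0 : charPoly W (n + 1) 1 z ε = 0) :
    z * ((∏ i : Fin (n + 1), ε * (W.cell i).realCoupling ε : ℝ) : ℂ) =
      (∏ i : Fin (n + 1), (W.cell i).portDet ε : ℝ) := by
  obtain ⟨ψ, hψ, h⟩ := Matrix.exists_mulVec_eq_zero_iff.2 h0
  have hε0 : ε ≠ 0 := by rintro rfl; norm_num at hε
  have hεinv : (ε : ℂ)⁻¹ = ε := by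
    rw [← Complex.ofReal_inv, inv_eq_of_mul_eq_one_left (by rw [← sq, hε])]
  have hw : ‖(ε : ℂ)‖ = 1 := by
    rw [Complex.norm_real, Real.norm_eq_abs, ← sq_eq_sq₀ (abs_nonneg _) zero_le_one, sq_abs, hε,
      one_pow]
  have hz0 : z ≠ 0 := by rintro rfl; simp at hz
  have hs0 (i : Fin (n + 1)) : seam z i ≠ 0 := by unfold seam; split_ifs <;> simp [hz0]
  have hsol (i : Fin (n + 1)) := (isSolution hw h i).realCoupling_mul
  by_cases hp : ∃ i, ψ (i, 0, black, port) ≠ 0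
  · have key := prod_eq_prod_of_cyclic (φ := fun i => ψ (i, 0, black, port))
      (α := fun i => (seam z (i + 1))⁻¹ * (ε * (W.cell i).realCoupling ε : ℝ))
      (β := fun i => (W.cell i).portDet ε) (fun i => by
        have := (hsol i).2
        rw [link₃_white h, hεinv] at this
        push_cast
        linear_combination -this)
      (by
        refine hne.imp (fun h i => ?_) (fun h i => ?_)
        · exact mul_ne_zero (inv_ne_zero (hs0 _)) (by exact_mod_cast mul_ne_zero hε0 (h i))
        · exact_mod_cast h i) hp
    rw [Finset.prod_mul_distrib, prod_add_one (fun i => (seam z i)⁻¹), Finset.prod_inv_distrib,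
      prod_seam, inv_inv] at key
    exact_mod_cast key
  by_cases hq : ∃ i, ψ (i, 0, white, port) ≠ 0
  · have key := prod_eq_prod_of_cyclic (φ := fun i => ψ (i, 0, white, port))
      (α := fun i => (W.cell ((i + 1 : Fin (n + 1)) : ℕ)).portDet ε)
      (β := fun i => seam z (i + 1) * (ε * (W.cell ((i + 1 : Fin (n + 1)) : ℕ)).realCoupling ε : ℝ))
      (fun i => by
        have := (hsol (i + 1)).1
        rw [link₃_black h, add_sub_cancel_right] at this
        push_cast
        linear_combination -this)
      (by
        refine hne.symm.imp (fun h i => ?_) (fun h i => ?_)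
        · exact_mod_cast h (i + 1)
        · exact mul_ne_zero (hs0 _) (by exact_mod_cast mul_ne_zero hε0 (h (i + 1)))) hq
    rw [Finset.prod_mul_distrib, prod_add_one (fun i => seam z i), prod_seam,
      prod_add_one (fun i : Fin (n + 1) => ((ε * (W.cell (i : ℕ)).realCoupling ε : ℝ) : ℂ)),
      prod_add_one (fun i : Fin (n + 1) => ((W.cell (i : ℕ)).portDet ε : ℂ)),
      Complex.inv_eq_conj hz, ← Complex.ofReal_prod, ← Complex.ofReal_prod] at key
    have := congrArg conj key
    rw [map_mul, Complex.conj_conj, Complex.conj_ofReal, Complex.conj_ofReal] at this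
    exact this.symm
  · push Not at hp hq
    have hport : ∀ i s, ψ (i, 0, s, port) = 0 := fun i s => by cases s; exacts [hp i, hq i]
    refine absurd (eq_zero_of_centre_of_port hw h (fun i => ?_) hport) hψ
    have hs := isSolution hw h i
    simp only [link₃_black h, link₃_white h, hport, mul_zero, neg_zero] at hs
    obtain ⟨hu, hv⟩ := hs.eq_zero_of_real (hne.imp (fun h => h i) (fun h => h i))
    rintro (_ | _)
    exacts [hu, hv]

/-- The spectral curve cannot meet both circles `w = 1` and `w = -1` of the unit torus. -/
theorem not_charPoly_one_and_neg_one (hW : W.IsPositive) {z z' : ℂ} (hz : ‖z‖ = 1)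
    (hz' : ‖z'‖ = 1) (h : charPoly W (n + 1) 1 z (1 : ℝ) = 0)
    (h' : charPoly W (n + 1) 1 z' (-1 : ℝ) = 0) : False := by
  have h1 := congrArg norm (mul_prod_realCoupling_eq_prod_portDet (W := W) (by norm_num)
    (.inl fun i => (Cell.realCoupling_one_pos (hW.cell i)).ne') hz h)
  have h2 := congrArg norm (mul_prod_realCoupling_eq_prod_portDet (W := W) (by norm_num)
    (.inr fun i => (Cell.portDet_neg_one_pos (hW.cell i)).ne') hz' h')
  simp only [norm_mul, hz, hz', Complex.norm_real, Real.norm_eq_abs, one_mul, Finset.abs_prod,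
    abs_neg, neg_one_mul] at h1 h2
  have hne : ∏ i : Fin (n + 1), |(W.cell i).portDet 1| ≠ 0 := by
    rw [← h1]
    exact Finset.prod_ne_zero_iff.2 fun i _ =>
      abs_ne_zero.2 (Cell.realCoupling_one_pos (hW.cell i)).ne'
  have l1 : ∏ i : Fin (n + 1), |(W.cell i).portDet 1| <
      ∏ i : Fin (n + 1), |(W.cell i).portDet (-1)| :=
    Finset.prod_lt_prod_of_nonempty
      (fun i hi => (abs_nonneg _).lt_of_ne' (Finset.prod_ne_zero_iff.1 hne i hi))
      (fun i _ => (Cell.abs_portDet_one_lt (hW.cell i)).trans_le (le_abs_self _))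
      Finset.univ_nonempty
  have l2 : ∏ i : Fin (n + 1), |(W.cell i).realCoupling (-1)| ≤
      ∏ i : Fin (n + 1), |(W.cell i).realCoupling 1| :=
    Finset.prod_le_prod (fun _ _ => abs_nonneg _)
      (fun i _ => (Cell.abs_realCoupling_neg_one_lt (hW.cell i)).le.trans (le_abs_self _))
  linarith

/-- On the unit torus, the points of the spectral curve with a given real second coordinate
have the same first coordinate, and it is real. -/
theorem exists_real_of_charPoly_eq_zero (hW : W.IsPositive) {ε : ℝ} (hε : ε = 1 ∨ ε = -1) :
    ∃ x : ℝ, ∀ z : ℂ, ‖z‖ = 1 → charPoly W (n + 1) 1 z ε = 0 → z = x := by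
  have hε2 : ε ^ 2 = 1 := by rcases hε with rfl | rfl <;> norm_num
  have hne : (∀ i : Fin (n + 1), (W.cell i).realCoupling ε ≠ 0) ∨
      ∀ i : Fin (n + 1), (W.cell i).portDet ε ≠ 0 := by
    rcases hε with rfl | rfl
    · exact .inl fun i => (Cell.realCoupling_one_pos (hW.cell i)).ne'
    · exact .inr fun i => (Cell.portDet_neg_one_pos (hW.cell i)).ne'
  refine ⟨(∏ i : Fin (n + 1), (W.cell i).portDet ε) /
    ∏ i : Fin (n + 1), ε * (W.cell i).realCoupling ε,
    fun z hz h => ?_⟩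
  have key := mul_prod_realCoupling_eq_prod_portDet hε2 hne hz h
  have hA : ∏ i : Fin (n + 1), ε * (W.cell i).realCoupling ε ≠ 0 := by
    -- by the closing condition the two products could only vanish together
    intro hA
    rw [hA, Complex.ofReal_zero, mul_zero, eq_comm, Complex.ofReal_eq_zero] at key
    rw [Finset.prod_eq_zero_iff] at hA key
    obtain ⟨i, -, hi⟩ := hA
    obtain ⟨j, -, hj⟩ := key
    rcases hne with h | h
    · refine h i ((mul_eq_zero.1 hi).resolve_left ?_)
      rintro rfl
      norm_num at hε2
    · exact h j hj
  rw [Complex.ofReal_div, eq_div_iff (by exact_mod_cast hA), key]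

end OneTwo

theorem mainTheorem9 (k : ℕ) (hk : 1 ≤ k) (W : OneTwo.Weights)
    (hpos : W.IsPositive) (hper : W.IsPeriodic k 1) :
    OneTwo.spectralCurve W k 1 ∩ OneTwo.unitTorus = ∅ ∨
      ∃ x y : ℝ, OneTwo.spectralCurve W k 1 ∩ OneTwo.unitTorus = {((x : ℂ), (y : ℂ))} := by
  obtain ⟨n, rfl⟩ := Nat.exists_eq_add_of_le' hk
  rw [or_iff_not_imp_left, ← Ne, ← Set.nonempty_iff_ne_empty]
  have real_of_mem : ∀ z w : ℂ, (z, w) ∈ OneTwo.spectralCurve W (n + 1) 1 ∩ OneTwo.unitTorus →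
      ∃ ε : ℝ, (ε = 1 ∨ ε = -1) ∧ w = ε := by
    rintro z w ⟨⟨-, -, h⟩, hz, hw⟩
    have him : w.im = 0 := by
      by_contra him
      exact OneTwo.charPoly_ne_zero_of_im_ne_zero hpos hz hw him h
    have hwre : w = (w.re : ℂ) := Complex.ext rfl him
    refine ⟨w.re, ?_, hwre⟩
    rwa [hwre, Complex.norm_real, Real.norm_eq_abs, abs_eq zero_le_one] at hw
  rintro ⟨⟨z, w⟩, hzw⟩
  obtain ⟨ε, hε, rfl⟩ := real_of_mem z w hzw
  obtain ⟨x, hx⟩ := OneTwo.exists_real_of_charPoly_eq_zero (n := n) hpos hε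
  obtain rfl := hx z hzw.2.1 hzw.1.2.2
  refine ⟨x, ε, Set.eq_singleton_iff_unique_mem.2 ⟨hzw, ?_⟩⟩
  rintro ⟨z', w'⟩ h'
  obtain ⟨ε', hε', rfl⟩ := real_of_mem z' w' h'
  obtain rfl : ε' = ε := by
    rcases hε with rfl | rfl <;> rcases hε' with rfl | rfl
    · rfl
    · exact (OneTwo.not_charPoly_one_and_neg_one hpos hzw.2.1 h'.2.1 hzw.1.2.2 h'.1.2.2).elim
    · exact (OneTwo.not_charPoly_one_and_neg_one hpos h'.2.1 hzw.2.1 h'.1.2.2 hzw.1.2.2).elim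
    · rfl
  rw [hx z' h'.2.1 h'.1.2.2]
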